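/- For $(a,b)\in\mathbb R^2$ consider the Riccati equation \[ x^2\frac{dy}{dx}+(1+ax)\,y=b\,x^2+y^2 . \] There is a neighborhood $U\subset\mathbb R^2$ of the point $(a,b)=(-2,0)$ such that for every $(a,b)\in U$ the following holds. The equation has a unique formal power series solution $\phi=\sum_{n=2}^\infty\phi_n x^n\in x^2\,\mathbb C[[x]]$ (the formal series expansion of the center manifold), and $\phi$ is convergent (that is, it has a positive radius of convergence) if and only if \[ b=0\qquad\text{or}\qquad a=-b-2 . \] -/

import Mathlib

open Topology PowerSeries

/-- A formal power series `φ = ∑ φₙ xⁿ` in `x² ℂ⟦x⟧` that solves the Riccati equation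
`x² y' + (1 + a x) y = b x² + y²` formally: the formal series expansion of the center manifold. -/
def IsFormalCenterManifold (a b : ℝ) (φ : ℂ⟦X⟧) : Prop :=
  X ^ 2 ∣ φ ∧
    X ^ 2 * derivative ℂ φ + (1 + C (a : ℂ) * X) * φ
      = C (b : ℂ) * X ^ 2 + φ ^ 2

/-- A formal power series is convergent if it converges on some disc of positive radius about
the origin. -/
def IsConvergentSeries (φ : ℂ⟦X⟧) : Prop :=
  ∃ r : ℝ, 0 < r ∧ ∀ x : ℂ, ‖x‖ < r → Summable (fun n : ℕ => coeff n φ * x ^ n)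

/-!
The substitution `y = -x² u' / u` turns the Riccati equation into the linear equation
`x² u'' + (1 + (a + 2) x) u' + b u = 0`, whose formal solution with `u(0) = 1` has coefficients
determined by `(n + 1) uₙ₊₁ = -(n² + (a + 1) n + b) uₙ` (`linearSolution`). So
`φ = -x² u' / u` is a formal center manifold (`exists_isFormalCenterManifold`), and it is the only
one because, if `xⁿ` divides the difference of two of them, then the equation shows that `xⁿ⁺¹`
does too (`IsFormalCenterManifold.unique`).

If `φ` converges, then so does `ψ = -φ / x²`, and `u' = ψ u` bounds the coefficients of `u`
geometrically (`exists_coeff_bound_of_derivative_eq_mul`). But `|uₙ₊₁ / uₙ|` grows like `n`, so this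
forces some `uₙ` to vanish, that is, `n² + (a + 1) n + b = 0` for some `n`
(`exists_root_of_isConvergentSeries`). Near `(a, b) = (-2, 0)` the expression is close to `n (n - 1)`,
so only `n = 0` and `n = 1` are possible; these are the conditions `b = 0` and `a = -b - 2`.
Conversely, under either condition `φ = b x² / (1 - b x)`.
-/

/-! ### Existence and uniqueness of the formal center manifold -/

/-- The formal solution `u = ∑ uₙ xⁿ`, `u₀ = 1`, of
`x² u'' + (1 + (a + 2) x) u' + b u = 0`. -/
noncomputable def linearSolution (a b : ℝ) : ℂ⟦X⟧ :=
  mk fun n => ∏ k ∈ Finset.range n, (-((k : ℂ) ^ 2 + (a + 1) * k + b) / (k + 1))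

lemma coeff_zero_linearSolution (a b : ℝ) : coeff 0 (linearSolution a b) = 1 := by
  simp [linearSolution]

lemma coeff_succ_linearSolution (a b : ℝ) (n : ℕ) :
    coeff (n + 1) (linearSolution a b) * (n + 1)
      = -((n : ℂ) ^ 2 + (a + 1) * n + b) * coeff n (linearSolution a b) := by
  have h : (n : ℂ) + 1 ≠ 0 := by exact_mod_cast n.succ_ne_zero
  simp only [linearSolution, coeff_mk, Finset.prod_range_succ]
  field_simp

lemma linearSolution_ne_zero (a b : ℝ) : linearSolution a b ≠ 0 := fun h => by
  simpa [h] using coeff_zero_linearSolution a b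

lemma linearSolution_ode (a b : ℝ) :
    X ^ 2 * derivative ℂ (derivative ℂ (linearSolution a b))
      + (1 + C ((a : ℂ) + 2) * X) * derivative ℂ (linearSolution a b)
      + C (b : ℂ) * linearSolution a b = 0 := by
  set u := linearSolution a b
  obtain ⟨c, hc⟩ : ∃ c, c = (a : ℂ) + 2 := ⟨_, rfl⟩
  rw [← hc]
  ext n
  have h := coeff_succ_linearSolution a b n
  have e : X ^ 2 * derivative ℂ (derivative ℂ u)
      + (1 + C c * X) * derivative ℂ u + C (b : ℂ) * u
      = X ^ 2 * derivative ℂ (derivative ℂ u) + derivative ℂ u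
        + C c * (X ^ 1 * derivative ℂ u) + C (b : ℂ) * u := by ring
  rw [e]
  simp only [map_add, coeff_C_mul, coeff_X_pow_mul', coeff_derivative, map_zero]
  rcases n with _ | _ | n
  · simp at h ⊢
    linear_combination h
  · simp at h ⊢
    linear_combination h + coeff 1 u * hc
  · simp only [show 2 ≤ n + 1 + 1 by omega, show 1 ≤ n + 1 + 1 by omega, if_true,
      show n + 1 + 1 - 2 = n by omega, show n + 1 + 1 - 1 = n + 1 by omega]
    push_cast at h ⊢
    linear_combination h + (n + 2) * coeff (n + 2) u * hc

/-- The logarithmic-derivative substitution, with the denominator of `φ = -x² u' / u` cleared. -/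
lemma isFormalCenterManifold_of_mul_linearSolution {a b : ℝ} {φ : ℂ⟦X⟧} (hX : X ^ 2 ∣ φ)
    (h : φ * linearSolution a b = -(X ^ 2 * derivative ℂ (linearSolution a b))) :
    IsFormalCenterManifold a b φ := by
  refine ⟨hX, ?_⟩
  have ode := linearSolution_ode a b
  have hu := linearSolution_ne_zero a b
  set u := linearSolution a b
  have hd := congrArg (derivative ℂ) h
  simp only [Derivation.leibniz, map_neg, smul_eq_mul, pow_two, derivative_X] at hd
  rw [map_add, show C (2 : ℂ) = 2 from rfl] at ode
  refine mul_right_cancel₀ hu ?_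
  linear_combination X ^ 2 * hd + (1 + C (a : ℂ) * X - φ) * h - X ^ 2 * ode

lemma exists_isFormalCenterManifold (a b : ℝ) : ∃ φ : ℂ⟦X⟧, IsFormalCenterManifold a b φ ∧
    φ * linearSolution a b = -(X ^ 2 * derivative ℂ (linearSolution a b)) := by
  set u := linearSolution a b with hu
  have hinv : u⁻¹ * u = 1 := PowerSeries.inv_mul_cancel u (by
    rw [← coeff_zero_eq_constantCoeff_apply, hu, coeff_zero_linearSolution]
    exact one_ne_zero)
  have h : -(X ^ 2 * derivative ℂ u) * u⁻¹ * u = -(X ^ 2 * derivative ℂ u) := by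
    rw [mul_assoc, hinv, mul_one]
  exact ⟨_, isFormalCenterManifold_of_mul_linearSolution
    ⟨-(derivative ℂ u) * u⁻¹, by ring⟩ h, h⟩

lemma IsFormalCenterManifold.unique {a b : ℝ} {φ₁ φ₂ : ℂ⟦X⟧}
    (h₁ : IsFormalCenterManifold a b φ₁) (h₂ : IsFormalCenterManifold a b φ₂) : φ₁ = φ₂ := by
  obtain ⟨⟨ψ₁, hψ₁⟩, e₁⟩ := h₁
  obtain ⟨⟨ψ₂, hψ₂⟩, e₂⟩ := h₂
  -- The difference `d` satisfies `d = (φ₁ + φ₂ - a x) d - x² d'`, and the right-hand side vanishes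
  -- to a higher order than `d`.
  have key : ∀ n : ℕ, X ^ n ∣ φ₁ - φ₂ := by
    intro n
    induction n with
    | zero => simp
    | succ n ih =>
      obtain ⟨e, he⟩ := ih
      have hd : X ^ 2 * derivative ℂ (φ₁ - φ₂)
          = X ^ (n + 1) * ((n : ℂ⟦X⟧) * e + X * derivative ℂ e) := by
        rw [he, Derivation.leibniz, derivative_pow, derivative_X]
        rcases n with _ | n
        · simp; ring
        · simp only [smul_eq_mul, Nat.add_sub_cancel]; ring
      rw [map_sub] at hd
      refine ⟨X * (ψ₁ + ψ₂) * e - C (a : ℂ) * e - ((n : ℂ⟦X⟧) * e + X * derivative ℂ e), ?_⟩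
      linear_combination e₁ - e₂ - hd + (φ₁ + φ₂ - C (a : ℂ) * X) * he
        + X ^ n * e * (hψ₁ + hψ₂)
  refine sub_eq_zero.mp (PowerSeries.ext fun n => ?_)
  exact X_pow_dvd_iff.mp (key (n + 1)) n n.lt_succ_self

/-! ### Growth of coefficients -/

lemma IsConvergentSeries.exists_coeff_bound {φ : ℂ⟦X⟧} (h : IsConvergentSeries φ) :
    ∃ M : ℝ, 0 < M ∧ ∀ n, ‖coeff n φ‖ ≤ M * M ^ n := by
  obtain ⟨r, hr, hs⟩ := h
  have hx : ‖((r / 2 : ℝ) : ℂ)‖ = r / 2 := by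
    rw [Complex.norm_real, Real.norm_of_nonneg (by positivity)]
  obtain ⟨K, hK⟩ :=
    (hs ((r / 2 : ℝ) : ℂ) (by rw [hx]; linarith)).tendsto_atTop_zero.norm.bddAbove_range
  have hK' : ∀ n, ‖coeff n φ‖ * (r / 2) ^ n ≤ K := fun n => by
    have : ‖coeff n φ * ((r / 2 : ℝ) : ℂ) ^ n‖ ≤ K := hK ⟨n, rfl⟩
    rwa [norm_mul, norm_pow, hx] at this
  refine ⟨max K (r / 2)⁻¹, lt_max_of_lt_right (by positivity), fun n => ?_⟩
  have hK0 : 0 ≤ K := le_trans (by positivity) (hK' 0)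
  calc ‖coeff n φ‖ ≤ K * ((r / 2)⁻¹) ^ n := by
        rw [inv_pow, ← div_eq_mul_inv, le_div_iff₀ (by positivity)]
        exact hK' n
    _ ≤ _ := by
        gcongr
        · exact le_max_left _ _
        · exact le_max_right _ _

/-- Coefficients of a solution of `u' = ψ u` grow at most geometrically if those of `ψ` do. The
factor `n + 1` in the coefficients of `u'` absorbs the number of terms of the product. -/
lemma exists_coeff_bound_of_derivative_eq_mul {u ψ : ℂ⟦X⟧} {M : ℝ}
    (hψ : ∀ n, ‖coeff n ψ‖ ≤ M * M ^ n) (hu : derivative ℂ u = ψ * u) (n : ℕ) :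
    ‖coeff n u‖ ≤ ‖coeff 0 u‖ * M ^ n := by
  have hM : 0 ≤ M := by simpa using (norm_nonneg _).trans (hψ 0)
  induction n using Nat.strong_induction_on with
  | _ n ih =>
    rcases n with _ | n
    · simp
    · have h := congrArg (fun f => ‖coeff n f‖) hu
      simp only [coeff_derivative, coeff_mul, norm_mul] at h
      have hn : ‖(n : ℂ) + 1‖ = n + 1 := by
        rw [← Nat.cast_succ, Complex.norm_natCast, Nat.cast_succ]
      rw [hn] at h
      have hsum : ‖∑ p ∈ Finset.HasAntidiagonal.antidiagonal n, coeff p.1 ψ * coeff p.2 u‖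
          ≤ ∑ _p ∈ Finset.HasAntidiagonal.antidiagonal n, ‖coeff 0 u‖ * M ^ (n + 1) := by
        refine norm_sum_le_of_le _ fun p hp => ?_
        have hp' := Finset.HasAntidiagonal.mem_antidiagonal.mp hp
        rw [norm_mul]
        calc _ ≤ (M * M ^ p.1) * (‖coeff 0 u‖ * M ^ p.2) :=
              mul_le_mul (hψ _) (ih _ (by omega)) (norm_nonneg _) (by positivity)
          _ = _ := by rw [← hp']; ring
      rw [Finset.sum_const, Finset.Nat.card_antidiagonal, nsmul_eq_mul, ← h] at hsum
      push_cast at hsum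
      exact le_of_mul_le_mul_left (by linarith) (by positivity : (0 : ℝ) < n + 1)

/-- The coefficients of `linearSolution a b` grow factorially unless they terminate. -/
lemma exists_root_of_coeff_bound {a b M : ℝ} (hM : 0 < M)
    (h : ∀ n, ‖coeff n (linearSolution a b)‖ ≤ M ^ n) :
    ∃ n : ℕ, (n : ℝ) ^ 2 + (a + 1) * n + b = 0 := by
  by_contra! hne
  set f : ℕ → ℂ := fun n => coeff n (linearSolution a b) * ((1 / (2 * M) : ℝ) : ℂ) ^ n with hf
  have hnorm : ∀ n, ‖f n‖ = ‖coeff n (linearSolution a b)‖ * (1 / (2 * M)) ^ n := fun n => by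
    rw [hf, norm_mul, norm_pow, Complex.norm_real, Real.norm_of_nonneg (by positivity)]
  have hsum : Summable f := by
    refine Summable.of_norm_bounded (g := fun n => (1 / 2 : ℝ) ^ n)
      summable_geometric_two fun n => ?_
    rw [hnorm]
    calc _ ≤ M ^ n * (1 / (2 * M)) ^ n := by gcongr; exact h n
      _ = _ := by rw [← mul_pow]; congr 1; field_simp
  have hrec : ∀ n : ℕ, ‖coeff (n + 1) (linearSolution a b)‖ * (n + 1)
      = |(n : ℝ) ^ 2 + (a + 1) * n + b| * ‖coeff n (linearSolution a b)‖ := fun n => by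
    have := congrArg norm (coeff_succ_linearSolution a b n)
    rw [norm_mul, norm_mul, norm_neg, ← Nat.cast_succ, Complex.norm_natCast, Nat.cast_succ] at this
    rw [this, ← Real.norm_eq_abs, ← Complex.norm_real]
    push_cast
    rfl
  have hu : ∀ n, coeff n (linearSolution a b) ≠ 0 := fun n => by
    induction n with
    | zero => rw [coeff_zero_linearSolution]; exact one_ne_zero
    | succ n ih =>
      intro h0
      have := hrec n
      rw [h0, norm_zero, zero_mul] at this
      exact (mul_pos (abs_pos.mpr (hne n)) (norm_pos_iff.mpr ih)).ne this
  refine not_summable_of_ratio_norm_eventually_ge (r := 2) one_lt_two ?_ ?_ hsum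
  · refine Filter.Frequently.of_forall fun n => ?_
    rw [hnorm]
    have := norm_pos_iff.mpr (hu n)
    positivity
  · filter_upwards [Filter.eventually_ge_atTop ⌈8 * M + |a + 1| + |b| + 1⌉₊] with n hn
    have hn' : 8 * M + |a + 1| + |b| + 1 ≤ n := Nat.ceil_le.mp hn
    have hn1 : (1 : ℝ) ≤ n := by
      linarith [abs_nonneg (a + 1), abs_nonneg b]
    have hgrow : 4 * M * (n + 1) ≤ |(n : ℝ) ^ 2 + (a + 1) * n + b| := by
      refine le_trans ?_ (le_abs_self _)
      have h1 : -|a + 1| * n ≤ (a + 1) * n := by gcongr; exact neg_abs_le _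
      have h2 : |b| ≤ |b| * n := le_mul_of_one_le_right (abs_nonneg b) hn1
      have h3 : (8 * M + |a + 1| + |b| + 1) * n ≤ n * n := by gcongr
      have h4 : M ≤ M * n := le_mul_of_one_le_right hM.le hn1
      linarith [neg_abs_le b]
    rw [hnorm, hnorm]
    have hstep : 4 * M * ‖coeff n (linearSolution a b)‖
        ≤ ‖coeff (n + 1) (linearSolution a b)‖ := by
      refine le_of_mul_le_mul_right ?_ (by positivity : (0 : ℝ) < n + 1)
      rw [hrec n]
      calc _ = 4 * M * (n + 1) * ‖coeff n (linearSolution a b)‖ := by ring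
        _ ≤ _ := by gcongr
    calc 2 * (‖coeff n (linearSolution a b)‖ * (1 / (2 * M)) ^ n)
        = (4 * M * ‖coeff n (linearSolution a b)‖) * (1 / (2 * M)) ^ (n + 1) := by
          rw [pow_succ]; field_simp; ring
      _ ≤ _ := by gcongr

/-! ### Convergence of the formal center manifold -/

/-- A necessary condition for convergence, valid for all real `a` and `b`. -/
lemma exists_root_of_isConvergentSeries {a b : ℝ} {φ : ℂ⟦X⟧} (hφ : IsFormalCenterManifold a b φ)
    (hc : IsConvergentSeries φ) : ∃ n : ℕ, (n : ℝ) ^ 2 + (a + 1) * n + b = 0 := by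
  obtain ⟨φ', hφ', hmul⟩ := exists_isFormalCenterManifold a b
  obtain rfl := hφ.unique hφ'
  obtain ⟨M, hM, hbound⟩ := hc.exists_coeff_bound
  obtain ⟨ψ, rfl⟩ := hφ.1
  have hψ : derivative ℂ (linearSolution a b) = -ψ * linearSolution a b := by
    refine mul_left_cancel₀ (pow_ne_zero 2 (X_ne_zero (R := ℂ))) ?_
    linear_combination hmul
  -- Dividing by `x²` shifts the coefficients by two, so the bound needs a larger constant.
  have hM' : M * M ^ 2 ≤ (M + 1) ^ 3 := by
    rw [← pow_succ']; gcongr; linarith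
  refine exists_root_of_coeff_bound (M := (M + 1) ^ 3) (by positivity) fun n => ?_
  have := exists_coeff_bound_of_derivative_eq_mul (M := (M + 1) ^ 3) (fun n => ?_) hψ n
  · rwa [coeff_zero_linearSolution, norm_one, one_mul] at this
  · have h := hbound (n + 2)
    rw [coeff_X_pow_mul] at h
    rw [map_neg, norm_neg]
    calc ‖coeff n ψ‖ ≤ M * M ^ 2 * M ^ n := by rw [mul_assoc, ← pow_add, add_comm 2 n]; exact h
      _ ≤ _ := by
        gcongr
        calc M ≤ M + 1 := by linarith
          _ ≤ (M + 1) ^ 3 := le_self_pow₀ (by linarith) (by norm_num)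

/-- If `b (a + b + 2) = 0`, then the center manifold is `b x² / (1 - b x)`. -/
lemma isFormalCenterManifold_geometric {a b : ℝ} (h : b = 0 ∨ a = -b - 2) :
    IsFormalCenterManifold a b (C (b : ℂ) * X ^ 2 * mk fun n => (b : ℂ) ^ n) := by
  set G : ℂ⟦X⟧ := mk fun n => (b : ℂ) ^ n with hGdef
  have hG : G * (1 - C (b : ℂ) * X) = 1 := by
    rw [mul_sub, mul_one, mul_left_comm, mul_comm G X]
    ext (_ | n)
    · simp [hGdef]
    · rw [map_sub, coeff_C_mul, coeff_succ_X_mul, hGdef, coeff_mk, coeff_mk, coeff_one]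
      simp [pow_succ']
  have hne : G ≠ 0 := left_ne_zero_of_mul_eq_one hG
  have hG' : derivative ℂ G = C (b : ℂ) * G ^ 2 := by
    have hd := congrArg (derivative ℂ) hG
    simp only [Derivation.leibniz, map_sub, smul_eq_mul, derivative_X, derivative_C,
      Derivation.map_one_eq_zero] at hd
    linear_combination G * hd - derivative ℂ G * hG
  have hb : C (b : ℂ) * (C (a : ℂ) + C (b : ℂ) + 2) = (0 : ℂ⟦X⟧) := by
    rcases h with rfl | rfl
    · simp
    · simp only [Complex.ofReal_sub, Complex.ofReal_neg, Complex.ofReal_ofNat, map_sub, map_neg,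
        show C (2 : ℂ) = (2 : ℂ⟦X⟧) from rfl]
      ring
  refine ⟨⟨C (b : ℂ) * G, by ring⟩, ?_⟩
  simp only [Derivation.leibniz, smul_eq_mul, pow_two, derivative_X, derivative_C, hG']
  linear_combination X ^ 3 * G * hb + C (b : ℂ) * X ^ 2 * hG

lemma isConvergentSeries_geometric (b : ℝ) :
    IsConvergentSeries (C (b : ℂ) * X ^ 2 * mk fun n => (b : ℂ) ^ n) := by
  refine ⟨1 / (|b| + 1), by positivity, fun x hx => ?_⟩
  have hlt : ‖(b : ℂ) * x‖ < 1 := by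
    rw [norm_mul, Complex.norm_real, Real.norm_eq_abs]
    rw [lt_div_iff₀ (by positivity)] at hx
    linarith [norm_nonneg x]
  refine (summable_nat_add_iff 2).mp ?_
  refine ((summable_geometric_of_norm_lt_one hlt).mul_left ((b : ℂ) * x ^ 2)).congr fun n => ?_
  rw [mul_assoc (C (b : ℂ)), coeff_C_mul, coeff_X_pow_mul, coeff_mk]
  ring

theorem mainTheorem2 :
    ∃ U ∈ 𝓝 ((-2, 0) : ℝ × ℝ), ∀ a b : ℝ, (a, b) ∈ U →
      (∃! φ : ℂ⟦X⟧, IsFormalCenterManifold a b φ) ∧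
      ∀ φ : ℂ⟦X⟧, IsFormalCenterManifold a b φ →
        (IsConvergentSeries φ ↔ (b = 0 ∨ a = -b - 2)) := by
  refine ⟨Metric.ball (-2, 0) (1 / 2), Metric.ball_mem_nhds _ (by norm_num), fun a b hab => ?_⟩
  rw [Metric.mem_ball, Prod.dist_eq, max_lt_iff, Real.dist_eq, Real.dist_eq, abs_lt, abs_lt] at hab
  obtain ⟨⟨ha, -⟩, ⟨hb, -⟩⟩ := hab
  refine ⟨?_, fun φ hφ => ⟨fun hc => ?_, fun h => ?_⟩⟩
  · obtain ⟨φ, hφ, -⟩ := exists_isFormalCenterManifold a b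
    exact ⟨φ, hφ, fun _ h => h.unique hφ⟩
  · obtain ⟨n, hn⟩ := exists_root_of_isConvergentSeries hφ hc
    rcases n with _ | _ | n
    · left; simpa using hn
    · right; push_cast at hn; linarith
    · -- For `n ≥ 2` the expression `n (n - 1) + (a + 2) n + b` is positive.
      exfalso
      push_cast at hn
      have hn0 : (0 : ℝ) ≤ n := n.cast_nonneg
      nlinarith
  · obtain rfl := hφ.unique (isFormalCenterManifold_geometric h)
    exact isConvergentSeries_geometric b
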